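/- Let $M=(E,r)$ be a matroid on a finite nonempty ground set $E$, with rank function $r$ and $r(M)=r(E)$. Its Tutte polynomial is $$T_M(x,y)=\sum_{S\subseteq E}(x-1)^{r(M)-r(S)}(y-1)^{|S|-r(S)}.$$ Let $P(M)=\{p\in\mathbb R^E : p\ge 0,\ \sum_{i\in U}p_i\le r(U)\text{ for all }U\subseteq E,\ \sum_{i\in E}p_i=r(E)\}$ be the base polytope of $M$, let $\Delta=\operatorname{conv}\{\mathbf e_i : i\in E\}\subseteq\mathbb R^E$ and $\nabla=-\Delta$, and for integers $t,u\ge 0$ put $$Q_M(t,u)=\#\big((P(M)+u\Delta+t\nabla)\cap\mathbb Z^E\big).$$ Then $Q_M$ is a polynomial function of $(t,u)$; equivalently, there is a unique finitely supported family of rational coefficients $(c_{ij})_{i,j\ge 0}$ with $Q_M(t,u)=\sum_{i,j}c_{ij}\binom{u}{j}\binom{t}{i}$ for all integers $t,u\ge0$. Set $Q'_M(x,y)=\sum_{i,j}c_{ij}(x-1)^i(y-1)^j$. Then $$T_M(x,y)=-\,\frac{(xy-x-y)^{|E|-1}}{(-y)^{r(M)-1}(-x)^{|E|-r(M)-1}}\cdot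 Q'_M\!\left(\frac{-x}{xy-x-y},\frac{-y}{xy-x-y}\right)$$ as an identity of rational functions in $x,y$; that is, it holds for all elements $x,y$ of any field of characteristic $0$ with $x\ne0$, $y\ne0$ and $xy-x-y\neq 0$. (Exponents may be negative.) -/

import Mathlib

open scoped Pointwise

noncomputable section

namespace TutteLattice

/-! ### Lattice point counts for an integer rank function `r` on a finite set `E` -/

section RankFunction

variable {E : Type*} [Fintype E]

/-- The extended polymatroid `EP = {x ∈ ℝ^E | x ≥ 0 and x · e_U ≤ r(U) for all U ⊆ E}`. -/
def extendedPolymatroid (r : Finset E → ℕ) : Set (E → ℝ) :=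
  {x | (∀ i, 0 ≤ x i) ∧ ∀ U : Finset E, ∑ i ∈ U, x i ≤ (r U : ℝ)}

/-- The base polytope `P = EP ∩ {x ∈ ℝ^E | x · e_E = r(E)}`. -/
def basePolytope (r : Finset E → ℕ) : Set (E → ℝ) :=
  extendedPolymatroid r ∩ {x | ∑ i, x i = (r Finset.univ : ℝ)}

/-- The polytope `P + uΔ + t∇` (Minkowski sum in `ℝ^E`), where `Δ = conv {e_i | i ∈ E}` is the
standard simplex and `∇ = -Δ`. -/
def sumPolytope (r : Finset E → ℕ) (t u : ℕ) : Set (E → ℝ) :=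
  basePolytope r + (u : ℝ) • stdSimplex ℝ E + (t : ℝ) • (-stdSimplex ℝ E)

/-- `Q(t,u)`, the number of lattice points of the (bounded) polytope `P + uΔ + t∇`. -/
def latticeCount (r : Finset E → ℕ) (t u : ℕ) : ℕ :=
  {z : E → ℤ | (fun i => (z i : ℝ)) ∈ sumPolytope r t u}.ncard

/-- The finitely supported array `c` satisfies `Q(t,u) = ∑_{i,j} c_{ij} (u choose j) (t choose i)`
for all `t, u ≥ 0`. -/
def IsBinomialExpansion (r : Finset E → ℕ) (c : ℕ × ℕ →₀ ℚ) : Prop :=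
  ∀ t u : ℕ, (latticeCount r t u : ℚ) =
    c.sum fun ij a => a * (u.choose ij.2 : ℚ) * (t.choose ij.1 : ℚ)

open Classical in
/-- `Q'(x,y) = ∑_{i,j} c_{ij} (x-1)^i (y-1)^j`, where `c` is the array of coefficients of `Q` in the
binomial basis (with the value `0` if there were no such array). The variable `X 0` is `x` and
`X 1` is `y`. -/
def latticePoly (r : Finset E → ℕ) : MvPolynomial (Fin 2) ℚ :=
  if h : ∃ c, IsBinomialExpansion r c then
    h.choose.sum fun ij a =>
      MvPolynomial.C a * (MvPolynomial.X 0 - 1) ^ ij.1 * (MvPolynomial.X 1 - 1) ^ ij.2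
  else 0

end RankFunction

/-! ### Matroids -/

section Matroid

variable {α : Type*} (M : Matroid α)

/-- The rank `r(X)` of a set `X` in `M`, as a natural number (used for matroids on finite ground
sets, where the extended rank is finite). -/
def rk (X : Set α) : ℕ := (M.eRk X).toNat

/-- The rank function of `M`, as a function of the finite subsets of the ground set `M.E`. -/
def rankFun (U : Finset M.E) : ℕ := rk M (Subtype.val '' (U : Set M.E))

/-- The Tutte polynomial `T_M(x,y) = ∑_{S ⊆ E} (x-1)^{r(M)-r(S)} (y-1)^{|S|-r(S)}`, where `X 0` is
`x` and `X 1` is `y`. The natural number subtractions do not truncate,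
since `r(S) ≤ r(M)` and `r(S) ≤ |S|`. -/
def tuttePoly [M.Finite] : MvPolynomial (Fin 2) ℚ :=
  ∑ S ∈ M.ground_finite.toFinset.powerset,
    (MvPolynomial.X 0 - 1) ^ (rk M M.E - rk M (S : Set α)) *
      (MvPolynomial.X 1 - 1) ^ (S.card - rk M (S : Set α))

end Matroid

end TutteLattice

end

namespace TutteLattice

open Finset
open scoped Polynomial

/-! Let `S` be the positive support of a lattice point `z`. Write `g = z(S) - r(S)` for its excess
and `h = r(E) - r(S) - z(Sᶜ)` for its deficit; both are nonnegative. Comparing `z` with the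
indicator vector of a base that meets `S` in `r(S)` elements shows that `z` is counted by `Q(t,u)`
exactly when `h - g = t - u` and `g ≤ u` (`latticeCount_eq_excess_deficit`).

A diagonal `h - g = const` through a point of the box `g ≤ u`, `h ≤ t` meets the hook with corner
`(t,u)` once. Hence the sum of `Q` over that hook counts the whole box, and stars and bars on each
positive support turns this into a sum over `S` of products of two binomial coefficients
(`latticeCount_hook_sum`).

Let a linear functional send `X^i Y^j` to `(t choose i)(u choose j)`. Summing over hooks becomes
multiplication by `1 + X + Y`, and the sum over `S` becomes the value of `homogTutte`. That
polynomial is divisible by `1 + X + Y`, and the quotient holds the coefficients of `Q`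
(`exists_isBinomialExpansion`). The stated substitution makes each summand a common factor times the
Tutte term of `S`. -/

/-- Every set `S` meets in `r S` elements some set `B` of size `r E` that is independent in the
sense that its trace on each `U` has at most `r U` elements. Rank functions of matroids have this
property. -/
def HasAdaptedBases {E : Type*} [Fintype E] [DecidableEq E] (r : Finset E → ℕ) : Prop :=
  ∀ S, ∃ B : Finset E, B.card = r univ ∧ (B ∩ S).card = r S ∧ ∀ U, (B ∩ U).card ≤ r U

/-! ### Inequalities describing the lattice points of `P + uΔ + t∇` -/

/-- The set of coordinates at which an integer vector is positive. -/
def posSupport {E : Type*} [Fintype E] (z : E → ℤ) : Finset E := univ.filter fun i => 0 < z i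

theorem mem_posSupport {E : Type*} [Fintype E] {z : E → ℤ} {i : E} :
    i ∈ posSupport z ↔ 0 < z i := by
  simp [posSupport]

theorem mem_smul_stdSimplex {E : Type*} [Fintype E] [Nonempty E] {c : ℝ} {v : E → ℝ} (hv : ∀ i, 0 ≤ v i)
    (hc : ∑ i, v i = c) : v ∈ c • stdSimplex ℝ E := by
  classical
  rcases eq_or_ne c 0 with rfl | h
  · have hv0 : v = 0 := by
      ext i
      exact (sum_eq_zero_iff_of_nonneg fun i _ => hv i).1 hc i (mem_univ i)
    obtain ⟨i⟩ := ‹Nonempty E›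
    exact ⟨Pi.single i 1, single_mem_stdSimplex ℝ i, by simp [hv0]⟩
  · have hc0 : 0 ≤ c := hc ▸ sum_nonneg fun i _ => hv i
    refine (Set.mem_smul_set_iff_inv_smul_mem₀ h _ _).2 ⟨fun i => ?_, ?_⟩
    · exact mul_nonneg (inv_nonneg.2 hc0) (hv i)
    · simp only [Pi.smul_apply, smul_eq_mul]
      rw [← mul_sum, hc, inv_mul_cancel₀ h]

/-- On any set `P` contributes at most the rank, `uΔ` at most `u`, and `t∇` nothing positive. The
bound on the positive support alone already suffices for the converse. -/
theorem le_of_mem_sumPolytope {E : Type*} [Fintype E] {r : Finset E → ℕ} {z : E → ℤ} {t u : ℕ}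
    (h : (fun i => (z i : ℝ)) ∈ sumPolytope r t u) :
    ∑ i, z i = r univ + u - t ∧ ∑ i ∈ posSupport z, z i ≤ r (posSupport z) + u := by
  obtain ⟨_, ⟨p, ⟨⟨hp0, hpU⟩, hp⟩, _, ⟨a, ha, rfl⟩, rfl⟩, _, ⟨b, hb, rfl⟩, hz⟩ := h
  have hzi (i : E) : (z i : ℝ) = p i + u * a i + t * b i := by
    simpa using (congrFun hz i).symm
  have hb0 (i : E) : b i ≤ 0 := by simpa using hb.1 i
  have hb1 : ∑ i, b i = -1 := by
    have := hb.2
    simp only [Pi.neg_apply, sum_neg_distrib] at this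
    linarith
  have hsum (U : Finset E) :
      ((∑ i ∈ U, z i : ℤ) : ℝ) = ∑ i ∈ U, p i + u * ∑ i ∈ U, a i + t * ∑ i ∈ U, b i := by
    push_cast
    rw [sum_congr rfl fun i _ => hzi i, sum_add_distrib, sum_add_distrib, mul_sum, mul_sum]
  constructor
  · have h := hsum univ
    rw [hp, ha.2, hb1] at h
    have : ((∑ i, z i : ℤ) : ℝ) = ((r univ + u - t : ℤ) : ℝ) := by
      rw [h]
      push_cast
      ring
    exact_mod_cast this
  · set S := posSupport z
    have h₁ : ∑ i ∈ S, a i ≤ 1 :=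
      ha.2 ▸ sum_le_sum_of_subset_of_nonneg (subset_univ S) fun i _ _ => ha.1 i
    have h₂ : (t : ℝ) * ∑ i ∈ S, b i ≤ 0 :=
      mul_nonpos_of_nonneg_of_nonpos t.cast_nonneg (sum_nonpos fun i _ => hb0 i)
    have h₃ : (u : ℝ) * ∑ i ∈ S, a i ≤ u := mul_le_of_le_one_right u.cast_nonneg h₁
    have : ((∑ i ∈ S, z i : ℤ) : ℝ) ≤ ((r S + u : ℤ) : ℝ) := by
      rw [hsum]
      push_cast
      linarith [hpU S]
    exact_mod_cast this

section Rank

variable {E : Type*} [Fintype E] [DecidableEq E] {r : Finset E → ℕ}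

theorem HasAdaptedBases.le_card (hr : HasAdaptedBases r) (S : Finset E) : r S ≤ S.card := by
  obtain ⟨B, -, h, -⟩ := hr S
  exact h ▸ card_le_card inter_subset_right

theorem HasAdaptedBases.le_rank (hr : HasAdaptedBases r) (S : Finset E) : r S ≤ r univ := by
  obtain ⟨B, h₁, h, -⟩ := hr S
  exact h ▸ h₁ ▸ card_le_card inter_subset_left

theorem HasAdaptedBases.rank_sub_le (hr : HasAdaptedBases r) (S : Finset E) :
    r univ - r S ≤ Sᶜ.card := by
  obtain ⟨B, h₁, h, -⟩ := hr S
  have h₂ := card_sdiff_add_card_inter B S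
  have h₃ : (B \ S).card ≤ Sᶜ.card :=
    card_le_card fun i hi => mem_compl.2 (mem_sdiff.1 hi).2
  omega

/-- The point of `P` can always be taken to be the indicator vector `p` of an adapted base; the
positive and negative parts of `z - p` then supply `uΔ` and `t∇`. -/
theorem mem_sumPolytope_of_le [Nonempty E] (hr : HasAdaptedBases r) {z : E → ℤ} {t u : ℕ}
    (hz : ∑ i, z i = r univ + u - t)
    (hS : ∑ i ∈ posSupport z, z i ≤ r (posSupport z) + u) :
    (fun i => (z i : ℝ)) ∈ sumPolytope r t u := by
  obtain ⟨B, hB, hBS, hBU⟩ := hr (posSupport z)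
  obtain ⟨e⟩ := id ‹Nonempty E›
  set p : E → ℤ := fun i => if i ∈ B then 1 else 0 with hp
  have hpsum (U : Finset E) : ∑ i ∈ U, p i = (B ∩ U).card := by
    simp [hp, sum_ite_mem, inter_comm]
  have hpsum_univ : ∑ i, p i = r univ := by rw [hpsum, inter_univ, hB]
  -- On the positive support `z ≥ 1 ≥ p`, and off it `z ≤ 0 ≤ p`.
  have hpos : ∑ i, max (z i - p i) 0 = ∑ i ∈ posSupport z, (z i - p i) := by
    rw [posSupport, sum_filter]
    refine sum_congr rfl fun i _ => ?_
    simp only [hp]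
    split_ifs <;> omega
  -- The unused part of `u` is placed at an arbitrary coordinate `e`, where `∇` cancels it again.
  set k : ℤ := u - ∑ i, max (z i - p i) 0 with hk
  have hk0 : 0 ≤ k := by
    rw [hk, hpos, sum_sub_distrib, hpsum, hBS]
    linarith
  set a : E → ℤ := fun i => max (z i - p i) 0 + if i = e then k else 0 with ha
  have hasum : ∑ i, a i = u := by simp [ha, sum_add_distrib, hk]
  have ha0 (i : E) : 0 ≤ a i := by
    simp only [ha]
    split_ifs <;> positivity
  have hab (i : E) : 0 ≤ a i - (z i - p i) := by
    simp only [ha]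
    split_ifs <;> omega
  have hbsum : ∑ i, (a i - (z i - p i)) = t := by
    rw [sum_sub_distrib, sum_sub_distrib, hasum, hz, hpsum_univ]
    ring
  refine Set.mem_add.2 ⟨fun i => (p i : ℝ) + a i, Set.add_mem_add (b := fun i => (a i : ℝ))
    (a := fun i => (p i : ℝ)) ⟨⟨fun i => ?_, fun U => ?_⟩, ?_⟩ (mem_smul_stdSimplex ?_ ?_),
    fun i => -((a i - (z i - p i) : ℤ) : ℝ), ?_, ?_⟩
  · simp only [hp]
    split_ifs <;> simp
  · have h : ∑ i ∈ U, p i ≤ (r U : ℤ) := by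
      rw [hpsum]
      exact_mod_cast hBU U
    change ∑ i ∈ U, (p i : ℝ) ≤ r U
    exact_mod_cast h
  · change ∑ i, (p i : ℝ) = r univ
    exact_mod_cast hpsum_univ
  · exact fun i => by exact_mod_cast ha0 i
  · exact_mod_cast hasum
  · rw [Set.smul_set_neg, Set.mem_neg]
    refine mem_smul_stdSimplex (fun i => ?_) ?_
    · simp only [Pi.neg_apply, neg_neg]
      exact_mod_cast hab i
    · simp only [Pi.neg_apply, neg_neg]
      exact_mod_cast hbsum
  · ext i
    simp

theorem latticeCount_eq [Nonempty E] (hr : HasAdaptedBases r) (t u : ℕ) :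
    latticeCount r t u = {z : E → ℤ | ∑ i, z i = r univ + u - t ∧
      ∑ i ∈ posSupport z, z i ≤ r (posSupport z) + u}.ncard := by
  rw [latticeCount]
  congr 1
  ext z
  exact ⟨le_of_mem_sumPolytope, fun h => mem_sumPolytope_of_le hr h.1 h.2⟩

end Rank

/-! ### Adapted bases in matroids -/

section Matroid

variable {α : Type*} (M : Matroid α)

/-- Extend a basis of `S` to a base `B`: the trace of `B` on any set is independent, and on `S` it
contains a basis. -/
theorem hasAdaptedBases_rankFun [M.Finite] [Fintype M.E] [DecidableEq M.E] :
    HasAdaptedBases (rankFun M) := by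
  classical
  intro S
  have hcast (X : Set α) (hX : X ⊆ M.E) : (rk M X : ℕ∞) = M.eRk X := by
    refine ENat.natCast_toNat (ne_top_of_le_ne_top ?_ (M.eRk_le_encard X))
    exact (M.ground_finite.subset hX).encard_lt_top.ne
  have hsub (U : Finset M.E) : Subtype.val '' (U : Set M.E) ⊆ M.E := by
    rintro _ ⟨i, -, rfl⟩
    exact i.2
  obtain ⟨I, hI⟩ := M.exists_isBasis (Subtype.val '' (S : Set M.E)) (hsub S)
  obtain ⟨B, hB, hIB⟩ := hI.indep.exists_isBase_superset
  have hcard (U : Finset M.E) : (((univ.filter fun i : M.E => i.1 ∈ B) ∩ U).card : ℕ∞) =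
      (B ∩ Subtype.val '' (U : Set M.E)).encard := by
    rw [← Set.encard_coe_eq_coe_finsetCard, ← Subtype.val_injective.encard_image]
    congr 1
    ext x
    simp only [coe_inter, coe_filter, mem_univ, true_and, Set.mem_image, Set.mem_inter_iff,
      Set.mem_ofPred_eq, mem_coe]
    constructor
    · rintro ⟨i, ⟨h₁, h₂⟩, rfl⟩
      exact ⟨h₁, i, h₂, rfl⟩
    · rintro ⟨h₁, i, h₂, rfl⟩
      exact ⟨i, ⟨h₁, h₂⟩, rfl⟩
  have hle (U : Finset M.E) :
      (B ∩ Subtype.val '' (U : Set M.E)).encard ≤ M.eRk (Subtype.val '' (U : Set M.E)) :=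
    (hB.indep.inter_right _).encard_le_eRk_of_subset Set.inter_subset_right
  refine ⟨univ.filter fun i : M.E => i.1 ∈ B, ?_, ?_, fun U => ?_⟩
  · have h := hcard univ
    rw [inter_univ] at h
    have hE : Subtype.val '' ((univ : Finset M.E) : Set M.E) = M.E := by simp
    rw [hE, Set.inter_eq_left.2 hB.subset_ground, hB.encard_eq_eRank, ← M.eRk_ground,
      ← hcast _ subset_rfl] at h
    rw [rankFun, hE]
    exact_mod_cast h
  · have h : (B ∩ Subtype.val '' (S : Set M.E)).encard = M.eRk (Subtype.val '' (S : Set M.E)) := by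
      refine (hle S).antisymm ?_
      rw [← hI.encard_eq_eRk]
      exact Set.encard_le_encard (Set.subset_inter hIB hI.subset)
    rw [← hcard, ← hcast _ (hsub S)] at h
    exact Nat.cast_injective h
  · have h := hle U
    rw [← hcard, ← hcast _ (hsub U)] at h
    exact Nat.cast_le.1 h

end Matroid

/-! ### Stars and bars -/

section StarsAndBars

variable (ι : Type*) [Fintype ι]

/-- Functions with sum at most `k` correspond to functions with sum `k` and one extra argument. -/
def sumLeEquivSumOption (k : ℕ) :
    {f : ι → ℕ // ∑ i, f i ≤ k} ≃ {P : Option ι → ℕ // ∑ i, P i = k} where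
  toFun f := ⟨fun o => o.elim (k - ∑ i, f.1 i) f.1, by
    rw [Fintype.sum_option]
    exact Nat.sub_add_cancel f.2⟩
  invFun P := ⟨fun i => P.1 (some i), by
    have := P.2
    rw [Fintype.sum_option] at this
    change ∑ i, P.1 (some i) ≤ k
    omega⟩
  left_inv f := rfl
  right_inv P := by
    apply Subtype.ext
    funext o
    cases o with
    | some i => rfl
    | none =>
      have := P.2
      rw [Fintype.sum_option] at this
      change k - ∑ i, P.1 (some i) = P.1 none
      omega

theorem finite_sum_add_card_le (N : ℕ) :
    Finite {f : ι → ℕ // ∑ i, f i + Fintype.card ι ≤ N} := by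
  classical
  have : Finite {f : ι → ℕ // ∑ i, f i ≤ N} :=
    Finite.of_equiv _ ((sumLeEquivSumOption ι N).trans (Sym.equivNatSumOfFintype _ N).symm).symm
  exact Finite.of_injective
    (fun f => (⟨f.1, by have := f.2; omega⟩ : {f : ι → ℕ // ∑ i, f i ≤ N}))
    fun f g h => Subtype.ext (Subtype.mk.inj h)

/-- Adding the cardinality amounts to counting strictly positive vectors with sum at most `N`; in
this form the binomial coefficient is also right, namely zero, for small `N`. -/
theorem card_sum_add_card_le (N : ℕ) :
    Nat.card {f : ι → ℕ // ∑ i, f i + Fintype.card ι ≤ N} = N.choose (Fintype.card ι) := by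
  classical
  rcases lt_or_ge N (Fintype.card ι) with h | h
  · rw [Nat.choose_eq_zero_of_lt h]
    have : IsEmpty {f : ι → ℕ // ∑ i, f i + Fintype.card ι ≤ N} :=
      ⟨fun f => by have := f.2; omega⟩
    exact Nat.card_of_isEmpty
  · obtain ⟨k, rfl⟩ := Nat.exists_eq_add_of_le h
    have e : {f : ι → ℕ // ∑ i, f i + Fintype.card ι ≤ Fintype.card ι + k} ≃
        {f : ι → ℕ // ∑ i, f i ≤ k} := Equiv.subtypeEquivRight fun f => by omega
    rw [Nat.card_congr (e.trans ((sumLeEquivSumOption ι k).trans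
      (Sym.equivNatSumOfFintype _ k).symm)), Nat.card_eq_fintype_card, Sym.card_sym_eq_choose,
      Fintype.card_option, Nat.add_right_comm, Nat.add_sub_cancel, Nat.choose_symm_add]

end StarsAndBars

/-! ### Counting by excess and deficit -/

/-- Counting the points with `g ≤ u` and `h ≤ t` along the fibres of `h - g`, each of which meets
the hook with corner `(t, u)` once. -/
theorem ncard_eq_hook_sum {X : Type*} (g h : X → ℕ)
    (hfin : ∀ t u, {x | g x ≤ u ∧ h x ≤ t}.Finite) (t u : ℕ) :
    {x | g x ≤ u ∧ h x ≤ t}.ncard = {x | h x + u = g x + t ∧ g x ≤ u}.ncard +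
      ∑ k ∈ range t, {x | h x + u = g x + k ∧ g x ≤ u}.ncard +
      ∑ k ∈ range u, {x | h x + k = g x + t ∧ g x ≤ k}.ncard := by
  classical
  set A := (hfin t u).toFinset with hA
  have hmem (x : X) : x ∈ A ↔ g x ≤ u ∧ h x ≤ t := by simp [hA]
  have h₁ : {x | h x + u = g x + t ∧ g x ≤ u}.ncard =
      (A.filter fun x => h x + u = g x + t).card := by
    rw [← Set.ncard_coe_finset]
    congr 1
    ext x
    simp only [Set.mem_ofPred_eq, coe_filter, hmem]
    omega
  -- These diagonals meet the hook at `(k, u)` with `k = h x + u - g x`; the subtraction is exact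
  -- since `g x ≤ u`.
  have h₂ : ∑ k ∈ range t, {x | h x + u = g x + k ∧ g x ≤ u}.ncard =
      (A.filter fun x => h x + u < g x + t).card := by
    rw [card_eq_sum_card_fiberwise (f := fun x => h x + u - g x) (t := range t)]
    · refine sum_congr rfl fun k hk => ?_
      rw [← Set.ncard_coe_finset]
      congr 1
      ext x
      have := mem_range.1 hk
      simp only [Set.mem_ofPred_eq, coe_filter, mem_filter, hmem]
      omega
    · intro x hx
      simp only [coe_filter, hmem, Set.mem_ofPred_eq] at hx
      simp only [coe_range, Set.mem_Iio]
      omega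
  -- These meet it at `(t, k)` with `k = g x + t - h x`, exact since `h x ≤ t`.
  have h₃ : ∑ k ∈ range u, {x | h x + k = g x + t ∧ g x ≤ k}.ncard =
      (A.filter fun x => g x + t < h x + u).card := by
    rw [card_eq_sum_card_fiberwise (f := fun x => g x + t - h x) (t := range u)]
    · refine sum_congr rfl fun k hk => ?_
      rw [← Set.ncard_coe_finset]
      congr 1
      ext x
      have := mem_range.1 hk
      simp only [Set.mem_ofPred_eq, coe_filter, mem_filter, hmem]
      omega
    · intro x hx
      simp only [coe_filter, hmem, Set.mem_ofPred_eq] at hx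
      simp only [coe_range, Set.mem_Iio]
      omega
  rw [h₁, h₂, h₃, Set.ncard_eq_toFinset_card _ (hfin t u), ← hA,
    ← card_filter_add_card_filter_not (s := A) fun x => h x + u = g x + t, add_assoc,
    ← card_filter_add_card_filter_not
      (s := A.filter fun x => ¬h x + u = g x + t) fun x => h x + u < g x + t, filter_filter,
    filter_filter]
  refine congrArg₂ _ rfl (congrArg₂ _ (congrArg card ?_) (congrArg card ?_)) <;>
  · ext x
    simp only [mem_filter]
    refine and_congr_right fun _ => ?_
    omega

section Count

variable {E : Type*} [Fintype E] [DecidableEq E] {r : Finset E → ℕ}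

/-- The least `u` for which `z` lies in some `P + uΔ + t∇`. -/
def excess (r : Finset E → ℕ) (z : E → ℤ) : ℕ :=
  (∑ i ∈ posSupport z, z i - r (posSupport z)).toNat

/-- The least `t` for which `z` lies in some `P + uΔ + t∇`. -/
def deficit (r : Finset E → ℕ) (z : E → ℤ) : ℕ :=
  (r univ - r (posSupport z) - ∑ i ∈ (posSupport z)ᶜ, z i).toNat

/-- Truncation is harmless: every entry on the positive support is at least `1`, and the rank is at
most the cardinality. -/
theorem excess_eq (hr : HasAdaptedBases r) (z : E → ℤ) :
    (excess r z : ℤ) = ∑ i ∈ posSupport z, z i - r (posSupport z) := by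
  refine Int.toNat_of_nonneg (sub_nonneg.2 ?_)
  calc (r (posSupport z) : ℤ) ≤ (posSupport z).card := by exact_mod_cast hr.le_card _
    _ = ∑ i ∈ posSupport z, 1 := by simp
    _ ≤ _ := sum_le_sum fun i hi => mem_posSupport.1 hi

theorem deficit_eq (hr : HasAdaptedBases r) (z : E → ℤ) :
    (deficit r z : ℤ) = r univ - r (posSupport z) - ∑ i ∈ (posSupport z)ᶜ, z i := by
  refine Int.toNat_of_nonneg ?_
  have h₁ : ∑ i ∈ (posSupport z)ᶜ, z i ≤ 0 := sum_nonpos fun i hi =>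
    not_lt.1 fun h => mem_compl.1 hi (mem_posSupport.2 h)
  have h₂ := hr.le_rank (posSupport z)
  omega

theorem latticeCount_eq_excess_deficit [Nonempty E] (hr : HasAdaptedBases r) (t u : ℕ) :
    latticeCount r t u =
      {z : E → ℤ | deficit r z + u = excess r z + t ∧ excess r z ≤ u}.ncard := by
  rw [latticeCount_eq hr]
  congr 1
  ext z
  have h₁ := excess_eq hr z
  have h₂ := deficit_eq hr z
  have h₃ := sum_add_sum_compl (posSupport z) z
  simp only [Set.mem_ofPred_eq]
  omega

/-- Integer vectors with positive support `S` correspond to pairs of vectors of natural numbers. -/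
def posSupportEquiv (S : Finset E) :
    {z : E → ℤ // posSupport z = S} ≃ (S → ℕ) × ((Sᶜ : Finset E) → ℕ) where
  toFun z := (fun i => (z.1 i - 1).toNat, fun i => (-z.1 i).toNat)
  invFun p := ⟨fun i => if h : i ∈ S then p.1 ⟨i, h⟩ + 1 else -p.2 ⟨i, mem_compl.2 h⟩, by
    ext i
    rw [mem_posSupport]
    split_ifs with h
    · exact iff_of_true (by omega) h
    · exact iff_of_false (by omega) h⟩
  left_inv z := by
    obtain ⟨z, rfl⟩ := z
    apply Subtype.ext
    funext i
    dsimp only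
    split_ifs with h
    · have := mem_posSupport.1 h
      omega
    · have := mt mem_posSupport.2 h
      omega
  right_inv p := by
    refine Prod.ext (funext fun i => ?_) (funext fun i => ?_)
    · simp [i.2]
    · have := mem_compl.1 i.2
      simp [this]

/-- `posSupportEquiv` restricted to vectors of bounded excess and deficit. -/
def boundedPosSupportEquiv (hr : HasAdaptedBases r) (S : Finset E) (t u : ℕ) :
    {z : {z : E → ℤ // posSupport z = S} // excess r z.1 ≤ u ∧ deficit r z.1 ≤ t} ≃
      {f : S → ℕ // ∑ i, f i + Fintype.card S ≤ u + r S} ×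
      {f : (Sᶜ : Finset E) → ℕ // ∑ i, f i + Fintype.card (Sᶜ : Finset E) ≤
        t + (Sᶜ.card - (r univ - r S))} :=
  ((posSupportEquiv S).subtypeEquiv fun z => by
    obtain ⟨z, rfl⟩ := z
    have h₁ := excess_eq hr z
    have h₂ := deficit_eq hr z
    -- This makes the subtraction in the deficit bound exact.
    have h₃ := hr.rank_sub_le (posSupport z)
    have h₄ := hr.le_rank (posSupport z)
    have h₅ : ((∑ i : posSupport z, (z i - 1).toNat : ℕ) : ℤ) =
        ∑ i ∈ posSupport z, z i - (posSupport z).card := by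
      rw [sum_coe_sort (posSupport z) fun i => (z i - 1).toNat, Nat.cast_sum, card_eq_sum_ones, Nat.cast_sum,
        ← sum_sub_distrib]
      refine sum_congr rfl fun i hi => ?_
      have := mem_posSupport.1 hi
      omega
    have h₆ : ((∑ i : ((posSupport z)ᶜ : Finset E), (-z i).toNat : ℕ) : ℤ) =
        -∑ i ∈ (posSupport z)ᶜ, z i := by
      rw [sum_coe_sort (posSupport z)ᶜ fun i => (-z i).toNat, Nat.cast_sum, ← sum_neg_distrib]
      refine sum_congr rfl fun i hi => ?_
      have := mt mem_posSupport.2 (mem_compl.1 hi)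
      omega
    change excess r z ≤ u ∧ deficit r z ≤ t ↔ ∑ i : posSupport z, (z i - 1).toNat + Fintype.card (posSupport z) ≤ _ ∧
      ∑ i : ((posSupport z)ᶜ : Finset E), (-z i).toNat +
        Fintype.card ((posSupport z)ᶜ : Finset E) ≤ _
    rw [Fintype.card_coe, Fintype.card_coe]
    omega).trans
  (Equiv.subtypeProdEquivProd (p := fun f : S → ℕ => ∑ i, f i + Fintype.card S ≤ u + r S)
    (q := fun f : (Sᶜ : Finset E) → ℕ => ∑ i, f i + Fintype.card (Sᶜ : Finset E) ≤
        t + (Sᶜ.card - (r univ - r S))))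

theorem finite_excess_deficit_fiber (hr : HasAdaptedBases r) (S : Finset E) (t u : ℕ) :
    {z : E → ℤ | posSupport z = S ∧ excess r z ≤ u ∧ deficit r z ≤ t}.Finite := by
  have := finite_sum_add_card_le S (u + r S)
  have := finite_sum_add_card_le (Sᶜ : Finset E) (t + (Sᶜ.card - (r univ - r S)))
  exact Finite.of_equiv _ ((boundedPosSupportEquiv hr S t u).symm.trans
    (Equiv.subtypeSubtypeEquivSubtypeInter (fun z : E → ℤ => posSupport z = S)
      fun z => excess r z ≤ u ∧ deficit r z ≤ t))

theorem ncard_excess_deficit_fiber (hr : HasAdaptedBases r) (S : Finset E) (t u : ℕ) :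
    {z : E → ℤ | posSupport z = S ∧ excess r z ≤ u ∧ deficit r z ≤ t}.ncard =
      (u + r S).choose S.card * (t + (Sᶜ.card - (r univ - r S))).choose Sᶜ.card := by
  rw [← Nat.card_coe_set_eq]
  refine (Nat.card_congr ((boundedPosSupportEquiv hr S t u).symm.trans
    (Equiv.subtypeSubtypeEquivSubtypeInter (fun z : E → ℤ => posSupport z = S)
      fun z => excess r z ≤ u ∧ deficit r z ≤ t))).symm.trans ?_
  rw [Nat.card_prod, card_sum_add_card_le, card_sum_add_card_le, Fintype.card_coe,
    Fintype.card_coe]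

theorem finite_excess_deficit (hr : HasAdaptedBases r) (t u : ℕ) :
    {z : E → ℤ | excess r z ≤ u ∧ deficit r z ≤ t}.Finite :=
  (Set.finite_iUnion fun S => finite_excess_deficit_fiber hr S t u).subset fun z hz =>
    Set.mem_iUnion.2 ⟨posSupport z, rfl, hz⟩

theorem ncard_excess_deficit (hr : HasAdaptedBases r) (t u : ℕ) :
    {z : E → ℤ | excess r z ≤ u ∧ deficit r z ≤ t}.ncard = ∑ S : Finset E,
      (u + r S).choose S.card * (t + (Sᶜ.card - (r univ - r S))).choose Sᶜ.card := by
  rw [Set.ncard_eq_toFinset_card _ (finite_excess_deficit hr t u),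
    card_eq_sum_card_fiberwise (f := posSupport) (t := univ) fun _ _ => mem_coe.2 (mem_univ _)]
  refine sum_congr rfl fun S _ => ?_
  rw [← ncard_excess_deficit_fiber hr, ← Set.ncard_coe_finset]
  congr 1
  ext z
  simp [and_comm]

/-- The lattice point counts along a hook add up to an explicit sum over subsets. -/
theorem latticeCount_hook_sum [Nonempty E] (hr : HasAdaptedBases r) (t u : ℕ) :
    latticeCount r t u + ∑ k ∈ range t, latticeCount r k u + ∑ k ∈ range u, latticeCount r t k =
      ∑ S : Finset E,
        (u + r S).choose S.card * (t + (Sᶜ.card - (r univ - r S))).choose Sᶜ.card := by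
  rw [← ncard_excess_deficit hr, ncard_eq_hook_sum _ _ (finite_excess_deficit hr)]
  simp only [latticeCount_eq_excess_deficit hr]

end Count

/-! ### Binomial functionals on polynomials -/

section BinomialFunctional

open Polynomial

variable {R : Type*} [CommRing R]

/-- The linear functional sending `X ^ i` to the binomial coefficient `n.choose i`. -/
noncomputable def binomEval (n : ℕ) : R[X] →ₗ[R] R :=
  Polynomial.lsum fun i => (n.choose i : R) • LinearMap.id

theorem binomEval_monomial (n i : ℕ) (a : R) :
    binomEval n (monomial i a) = (n.choose i : R) * a := by
  simp [binomEval]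

/-- On monomials this is the hockey-stick identity; it turns multiplication by a variable into
summation along one arm of a hook. -/
theorem binomEval_X_mul (n : ℕ) (p : R[X]) :
    binomEval n (X * p) = ∑ k ∈ range n, binomEval k p := by
  induction p using Polynomial.induction_on' with
  | add p q hp hq => simp only [mul_add, map_add, hp, hq, sum_add_distrib]
  | monomial i a =>
    rw [X_mul_monomial, binomEval_monomial]
    simp only [binomEval_monomial]
    rw [← sum_mul, ← Nat.cast_sum]
    congr 2
    induction n with
    | zero => simp
    | succ n ih => rw [sum_range_succ, ← ih, Nat.choose_succ_succ, add_comm]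

/-- Pascal's rule: each factor `1 + X` shifts `n` by one. -/
theorem binomEval_X_pow_mul_one_add_X_pow (n c e : ℕ) :
    binomEval n (X ^ c * (1 + X) ^ e : R[X]) = ((n + e).choose (c + e) : R) := by
  induction e generalizing c with
  | zero =>
    rw [pow_zero, mul_one, X_pow_eq_monomial, binomEval_monomial]
    simp
  | succ e ih =>
    have h : (X ^ c * (1 + X) ^ (e + 1) : R[X]) =
        X ^ c * (1 + X) ^ e + X ^ (c + 1) * (1 + X) ^ e := by ring
    rw [h, map_add, ih, ih, ← add_assoc n, ← add_assoc c, Nat.choose_succ_succ, Nat.cast_add,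
      add_right_comm c 1 e]

/-- The linear functional on polynomials in two variables that sends `X ^ i * Y ^ j` to
`t.choose i * u.choose j`, where `Y` is the outer variable. -/
noncomputable def binomEval₂ (t u : ℕ) (G : ℚ[X][X]) : ℚ := binomEval t (binomEval u G)

theorem binomEval₂_add (t u : ℕ) (G H : ℚ[X][X]) :
    binomEval₂ t u (G + H) = binomEval₂ t u G + binomEval₂ t u H := by
  simp [binomEval₂]

theorem binomEval₂_sum {ι : Type*} (s : Finset ι) (t u : ℕ) (G : ι → ℚ[X][X]) :
    binomEval₂ t u (∑ i ∈ s, G i) = ∑ i ∈ s, binomEval₂ t u (G i) := by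
  simp [binomEval₂]

theorem binomEval_C_mul (n : ℕ) (a : R) (p : R[X]) :
    binomEval n (C a * p) = a * binomEval n p := by
  rw [← smul_eq_C_mul, map_smul, smul_eq_mul]

theorem binomEval₂_X_mul (t u : ℕ) (G : ℚ[X][X]) :
    binomEval₂ t u (X * G) = ∑ k ∈ range u, binomEval₂ t k G := by
  simp [binomEval₂, binomEval_X_mul]

theorem binomEval₂_C_X_mul (t u : ℕ) (G : ℚ[X][X]) :
    binomEval₂ t u (C X * G) = ∑ k ∈ range t, binomEval₂ k u G := by
  simp [binomEval₂, binomEval_X_mul, binomEval_C_mul]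

theorem binomEval₂_one_add_X_add_X_mul (t u : ℕ) (G : ℚ[X][X]) :
    binomEval₂ t u ((1 + C X + X) * G) = binomEval₂ t u G +
      ∑ k ∈ range t, binomEval₂ k u G + ∑ k ∈ range u, binomEval₂ t k G := by
  rw [add_mul, add_mul, one_mul, binomEval₂_add, binomEval₂_add, binomEval₂_X_mul,
    binomEval₂_C_X_mul]

theorem binomEval₂_C_mul_map (t u c e : ℕ) (p : ℚ[X]) :
    binomEval₂ t u (C p * (X ^ c * (1 + X) ^ e)) =
      ((u + e).choose (c + e) : ℚ) * binomEval t p := by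
  rw [binomEval₂, binomEval_C_mul, binomEval_X_pow_mul_one_add_X_pow, mul_comm, ← nsmul_eq_mul,
    map_nsmul, nsmul_eq_mul]

/-- A function on `ℕ × ℕ` is determined by its sums over all hooks. -/
theorem eq_of_hook_sum_eq {f g : ℕ → ℕ → ℚ}
    (h : ∀ t u, f t u + ∑ k ∈ range t, f k u + ∑ k ∈ range u, f t k =
      g t u + ∑ k ∈ range t, g k u + ∑ k ∈ range u, g t k) (t u : ℕ) : f t u = g t u := by
  induction t using Nat.strong_induction_on generalizing u with
  | _ t iht =>
    induction u using Nat.strong_induction_on with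
    | _ u ihu =>
      have h₁ : ∑ k ∈ range t, f k u = ∑ k ∈ range t, g k u :=
        sum_congr rfl fun k hk => iht k (mem_range.1 hk) u
      have h₂ : ∑ k ∈ range u, f t k = ∑ k ∈ range u, g t k :=
        sum_congr rfl fun k hk => ihu k (mem_range.1 hk)
      have := h t u
      rw [h₁, h₂] at this
      linarith

/-- The polynomial in two variables with a given array of coefficients. -/
noncomputable def polyOfCoeffs : (ℕ × ℕ →₀ ℚ) →ₗ[ℚ] ℚ[X][X] :=
  Finsupp.linearCombination ℚ fun ij => monomial ij.2 (monomial ij.1 1)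

theorem polyOfCoeffs_surjective : Function.Surjective polyOfCoeffs := by
  intro G
  change G ∈ LinearMap.range polyOfCoeffs
  induction G using Polynomial.induction_on' with
  | add p q hp hq => exact add_mem hp hq
  | monomial j p =>
    induction p using Polynomial.induction_on' with
    | add p q hp hq =>
      rw [map_add]
      exact add_mem hp hq
    | monomial i a =>
      exact ⟨Finsupp.single (i, j) a, by simp [polyOfCoeffs, smul_monomial]⟩

theorem binomEval₂_polyOfCoeffs (t u : ℕ) (c : ℕ × ℕ →₀ ℚ) :
    binomEval₂ t u (polyOfCoeffs c) =
      c.sum fun ij a => a * (u.choose ij.2 : ℚ) * (t.choose ij.1 : ℚ) := by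
  rw [polyOfCoeffs, Finsupp.linearCombination_apply, Finsupp.sum, Finsupp.sum, binomEval₂_sum]
  refine sum_congr rfl fun ij _ => ?_
  rw [binomEval₂, smul_monomial, smul_monomial, binomEval_monomial, ← nsmul_eq_mul, map_nsmul,
    binomEval_monomial, nsmul_eq_mul, smul_eq_mul]
  ring

theorem eval₂_polyOfCoeffs {K : Type*} [Field K] [CharZero K] (x y : K) (c : ℕ × ℕ →₀ ℚ) :
    eval₂ (aeval x : ℚ[X] →ₐ[ℚ] K).toRingHom y (polyOfCoeffs c) =
      c.sum fun ij a => algebraMap ℚ K a * x ^ ij.1 * y ^ ij.2 := by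
  rw [polyOfCoeffs, Finsupp.linearCombination_apply, Finsupp.sum, Finsupp.sum, eval₂_finsetSum]
  refine sum_congr rfl fun ij _ => ?_
  simp [smul_monomial, eval₂_monomial, aeval_monomial]

theorem eq_zero_of_binomial_sum_eq_zero {c : ℕ × ℕ →₀ ℚ}
    (h : ∀ t u : ℕ, (c.sum fun ij a => a * (u.choose ij.2 : ℚ) * (t.choose ij.1 : ℚ)) = 0) :
    c = 0 := by
  -- At `t = i`, `u = j` only indices with `i' ≤ i` and `j' ≤ j` survive, and all but `(i, j)` have
  -- smaller total degree.
  suffices H : ∀ n i j, i + j = n → c (i, j) = 0 from Finsupp.ext fun ij => H _ ij.1 ij.2 rfl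
  intro n
  induction n using Nat.strong_induction_on with
  | _ n ih =>
    intro i j hij
    have hs := h i j
    rw [Finsupp.sum_eq_single (i, j)] at hs
    · simpa using hs
    · rintro ⟨i', j'⟩ hc hne
      rcases lt_or_ge i i' with hi | hi
      · simp [Nat.choose_eq_zero_of_lt hi]
      rcases lt_or_ge j j' with hj | hj
      · simp [Nat.choose_eq_zero_of_lt hj]
      refine absurd (ih (i' + j') ?_ i' j' rfl) hc
      by_contra hn
      exact hne (Prod.ext (by dsimp only; omega) (by dsimp only; omega))
    · simp

end BinomialFunctional

/-! ### Existence and uniqueness of the binomial expansion -/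

section Expansion

open Polynomial

variable {E : Type*} [Fintype E] [DecidableEq E] {r : Finset E → ℕ}

/-- The Tutte polynomial of `r`, homogenized so that it is `1 + X + Y` times the polynomial whose
coefficients are those of the lattice point count in the binomial basis. -/
noncomputable def homogTutte (r : Finset E → ℕ) : ℚ[X][X] :=
  ∑ S : Finset E, C (X ^ (r univ - r S) * (1 + X) ^ (Sᶜ.card - (r univ - r S))) *
    (X ^ (S.card - r S) * (1 + X) ^ r S)

theorem binomEval₂_homogTutte [Nonempty E] (hr : HasAdaptedBases r) (t u : ℕ) :
    binomEval₂ t u (homogTutte r) = (latticeCount r t u : ℚ) +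
      ∑ k ∈ range t, (latticeCount r k u : ℚ) + ∑ k ∈ range u, (latticeCount r t k : ℚ) := by
  have h := congrArg (Nat.cast (R := ℚ)) (latticeCount_hook_sum hr t u)
  push_cast at h
  rw [h, homogTutte, binomEval₂_sum]
  refine sum_congr rfl fun S _ => ?_
  rw [binomEval₂_C_mul_map, binomEval_X_pow_mul_one_add_X_pow, Nat.sub_add_cancel (hr.le_card S),
    Nat.add_sub_cancel' (hr.rank_sub_le S)]

/-- At `Y = -(1 + X)` one has `1 + Y = -X`, so all summands agree up to the sign `(-1)^|S|`, and
these signs cancel because `E` is nonempty. -/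
theorem one_add_X_add_X_dvd_homogTutte [Nonempty E] (hr : HasAdaptedBases r) :
    (1 + C X + X : ℚ[X][X]) ∣ homogTutte r := by
  have h : (1 + C X + X : ℚ[X][X]) = X - C (-(1 + X)) := by
    simp only [C_neg, C_add, C_1]
    ring
  rw [h, dvd_iff_isRoot, IsRoot.def, homogTutte, eval_finsetSum]
  have key (S : Finset E) :
      eval (-(1 + X) : ℚ[X]) (C (X ^ (r univ - r S) * (1 + X) ^ (Sᶜ.card - (r univ - r S))) *
        (X ^ (S.card - r S) * (1 + X) ^ r S)) =
      (((-1) ^ S.card : ℤ) : ℚ[X]) * (X ^ r univ * (1 + X) ^ (Fintype.card E - r univ)) := by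
    have h₁ := hr.le_card S
    have h₂ := hr.le_rank S
    have h₃ := hr.rank_sub_le S
    have h₄ := card_add_card_compl S
    obtain ⟨a, ha⟩ := Nat.exists_eq_add_of_le h₁
    obtain ⟨b, hb⟩ := Nat.exists_eq_add_of_le h₂
    obtain ⟨e, he⟩ := Nat.exists_eq_add_of_le h₃
    have e₁ : r univ - r S = b := by omega
    have e₂ : Sᶜ.card - (r univ - r S) = e := by omega
    have e₃ : S.card - r S = a := by omega
    have e₄ : Fintype.card E - r univ = e + a := by omega
    rw [e₂, e₁, e₃, e₄, ha, hb]
    simp only [eval_mul, eval_C, eval_pow, eval_X, eval_add, eval_one]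
    rw [show (1 + -(1 + X) : ℚ[X]) = -1 * X by ring, neg_eq_neg_one_mul (1 + X : ℚ[X]), mul_pow,
      mul_pow, pow_add, pow_add, pow_add]
    push_cast
    ring
  rw [sum_congr rfl fun S _ => key S, ← sum_mul, ← Int.cast_sum, ← powerset_univ,
    sum_powerset_neg_one_pow_card_of_nonempty univ_nonempty, Int.cast_zero, zero_mul]

theorem exists_isBinomialExpansion [Nonempty E] (hr : HasAdaptedBases r) :
    ∃ c, IsBinomialExpansion r c ∧ homogTutte r = (1 + C X + X) * polyOfCoeffs c := by
  obtain ⟨G, hG⟩ := one_add_X_add_X_dvd_homogTutte hr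
  obtain ⟨c, rfl⟩ := polyOfCoeffs_surjective G
  refine ⟨c, fun t u => ?_, hG⟩
  rw [← binomEval₂_polyOfCoeffs]
  refine eq_of_hook_sum_eq (f := fun t u => (latticeCount r t u : ℚ))
    (g := fun t u => binomEval₂ t u (polyOfCoeffs c)) (fun t u => ?_) t u
  rw [← binomEval₂_one_add_X_add_X_mul, ← hG, binomEval₂_homogTutte hr]

end Expansion

theorem IsBinomialExpansion.unique {E : Type*} [Fintype E] {r : Finset E → ℕ}
    {c c' : ℕ × ℕ →₀ ℚ} (hc : IsBinomialExpansion r c) (hc' : IsBinomialExpansion r c') :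
    c = c' := by
  refine sub_eq_zero.1 (eq_zero_of_binomial_sum_eq_zero fun t u => ?_)
  rw [Finsupp.sum_sub_index fun _ _ _ => by ring, ← hc t u, ← hc' t u, sub_self]

theorem latticePoly_eq {E : Type*} [Fintype E] {r : Finset E → ℕ} {c : ℕ × ℕ →₀ ℚ}
    (hc : IsBinomialExpansion r c) : latticePoly r = c.sum fun ij a =>
      MvPolynomial.C a * (MvPolynomial.X 0 - 1) ^ ij.1 * (MvPolynomial.X 1 - 1) ^ ij.2 := by
  have h : ∃ c, IsBinomialExpansion r c := ⟨c, hc⟩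
  rw [latticePoly, dif_pos h, h.choose_spec.unique hc]

/-! ### Substitution into `Q'` and the Tutte polynomial -/

section Evaluation

variable {E : Type*} [Fintype E] [DecidableEq E] {r : Finset E → ℕ}
  {K : Type*} [Field K] [CharZero K]

/-- The factor is `1 + X + Y` at `X = x - 1`, `Y = y - 1`, the shift built into `Q'`. -/
theorem aeval_latticePoly [Nonempty E] (hr : HasAdaptedBases r) (x y : K) :
    (x + y - 1) * MvPolynomial.aeval ![x, y] (latticePoly r) =
      ∑ S : Finset E, (x - 1) ^ (r univ - r S) * x ^ (Sᶜ.card - (r univ - r S)) *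
        ((y - 1) ^ (S.card - r S) * y ^ r S) := by
  obtain ⟨c, hc, h⟩ := exists_isBinomialExpansion hr
  have hL : MvPolynomial.aeval ![x, y] (latticePoly r) =
      (polyOfCoeffs c).eval₂ (Polynomial.aeval (x - 1) : ℚ[X] →ₐ[ℚ] K).toRingHom (y - 1) := by
    rw [eval₂_polyOfCoeffs, latticePoly_eq hc, Finsupp.sum, Finsupp.sum, map_sum]
    exact sum_congr rfl fun ij _ => by simp
  have h' := congrArg
    (Polynomial.eval₂ (Polynomial.aeval (x - 1) : ℚ[X] →ₐ[ℚ] K).toRingHom (y - 1)) h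
  rw [Polynomial.eval₂_mul, ← hL, homogTutte, Polynomial.eval₂_finsetSum] at h'
  have hf : Polynomial.eval₂ (Polynomial.aeval (x - 1) : ℚ[X] →ₐ[ℚ] K).toRingHom (y - 1)
      (1 + Polynomial.C Polynomial.X + Polynomial.X) = x + y - 1 := by
    simp [Polynomial.eval₂_add, add_sub_assoc]
  rw [← hf, ← h']
  refine sum_congr rfl fun S _ => ?_
  simp [Polynomial.eval₂_mul, Polynomial.eval₂_pow, Polynomial.eval₂_add]

theorem aeval_latticePoly_substituted [Nonempty E] (hr : HasAdaptedBases r) {x y : K}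
    (hx : x ≠ 0) (hy : y ≠ 0) (hd : x * y - x - y ≠ 0) :
    ∑ S : Finset E, (x - 1) ^ (r univ - r S) * (y - 1) ^ (S.card - r S) =
      -((x * y - x - y) ^ ((Fintype.card E : ℤ) - 1) /
          ((-y) ^ ((r univ : ℤ) - 1) * (-x) ^ ((Fintype.card E : ℤ) - (r univ : ℤ) - 1))) *
        MvPolynomial.aeval ![-x / (x * y - x - y), -y / (x * y - x - y)] (latticePoly r) := by
  set d := x * y - x - y with hd_def
  have h := aeval_latticePoly hr (-x / d) (-y / d)
  set Q := MvPolynomial.aeval ![-x / d, -y / d] (latticePoly r)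
  have h₁ : -x / d + -y / d - 1 = -(x * y) / d := by
    field_simp
    rw [hd_def]
    ring
  -- This and `hy1` explain the substitution: subtracting `1` swaps the prefactors `-x / d` and `-y
  -- / d`, so their exponents in each summand add up independently of `S`.
  have hx1 : -x / d - 1 = -y / d * (x - 1) := by
    field_simp
    rw [hd_def]
    ring
  have hy1 : -y / d - 1 = -x / d * (y - 1) := by
    field_simp
    rw [hd_def]
    ring
  have hrn := hr.le_card univ
  rw [card_univ] at hrn
  have key (S : Finset E) : (-x / d - 1) ^ (r univ - r S) *
        (-x / d) ^ (Sᶜ.card - (r univ - r S)) *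
        ((-y / d - 1) ^ (S.card - r S) * (-y / d) ^ r S) =
      (-y / d) ^ r univ * (-x / d) ^ (Fintype.card E - r univ) *
        ((x - 1) ^ (r univ - r S) * (y - 1) ^ (S.card - r S)) := by
    have h₁ := hr.le_card S
    have h₂ := hr.le_rank S
    have h₃ := hr.rank_sub_le S
    have h₄ := card_add_card_compl S
    have e₁ : r univ = (r univ - r S) + r S := by omega
    have e₂ : Fintype.card E - r univ = (Sᶜ.card - (r univ - r S)) + (S.card - r S) := by omega
    rw [hx1, hy1, e₂, mul_pow, mul_pow, pow_add]
    -- The fourth occurrence is the exponent of `-y / d` on the right.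
    nth_rewrite 4 [e₁]
    rw [pow_add]
    ring
  rw [h₁, sum_congr rfl fun S _ => key S, ← mul_sum] at h
  set T := ∑ S : Finset E, (x - 1) ^ (r univ - r S) * (y - 1) ^ (S.card - r S)
  obtain ⟨m, hm⟩ := Nat.exists_eq_add_of_le hrn
  rw [hm, Nat.add_sub_cancel_left] at h
  rw [hm]
  have e : (((r univ + m : ℕ) : ℤ) - (r univ : ℤ) - 1) = (m : ℤ) - 1 := by
    push_cast
    ring
  have hx' : -x ≠ 0 := neg_ne_zero.2 hx
  have hy' : -y ≠ 0 := neg_ne_zero.2 hy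
  rw [e, zpow_sub_one₀ hd, zpow_sub_one₀ hx', zpow_sub_one₀ hy', zpow_natCast, zpow_natCast,
    zpow_natCast]
  have hA : (-y) ^ r univ ≠ 0 := pow_ne_zero _ hy'
  have hB : (-x) ^ m ≠ 0 := pow_ne_zero _ hx'
  rw [div_pow, div_pow] at h
  rw [pow_add]
  have hC : d ^ r univ ≠ 0 := pow_ne_zero _ hd
  have hD : d ^ m ≠ 0 := pow_ne_zero _ hd
  -- With the powers replaced by nonzero atoms, solving `h` for `T` is plain field arithmetic.
  generalize (-y) ^ r univ = A at *
  generalize (-x) ^ m = B at *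
  generalize d ^ r univ = U at *
  generalize d ^ m = V at *
  have hT : T = U * V / (A * B) * (-(x * y) / d * Q) := by
    rw [h]
    field_simp
  rw [hT]
  field_simp

end Evaluation

theorem aeval_tuttePoly {α : Type*} (M : Matroid α) [M.Finite] [Fintype M.E]
    {K : Type*} [Field K] [CharZero K] (x y : K) :
    MvPolynomial.aeval ![x, y] (tuttePoly M) = ∑ S : Finset M.E,
      (x - 1) ^ (rankFun M univ - rankFun M S) * (y - 1) ^ (S.card - rankFun M S) := by
  classical
  rw [tuttePoly, map_sum]
  symm
  refine sum_bij (fun S _ => S.map (Function.Embedding.subtype _)) (fun S _ => ?_)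
    (fun S _ S' _ h => map_injective _ h) (fun U hU => ?_) fun S _ => ?_
  · rw [mem_powerset]
    intro i hi
    obtain ⟨j, -, rfl⟩ := mem_map.1 hi
    exact M.ground_finite.mem_toFinset.2 j.2
  · refine ⟨univ.filter fun i : M.E => i.1 ∈ U, mem_univ _, ?_⟩
    ext i
    simp only [mem_map, mem_filter, mem_univ, true_and, Function.Embedding.subtype_apply,
      Subtype.exists, exists_and_left, exists_prop, exists_eq_right_right]
    exact and_iff_left_of_imp fun h => M.ground_finite.mem_toFinset.1 (mem_powerset.1 hU h)
  · have h₁ : rankFun M univ = rk M M.E := by simp [rankFun]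
    have h₂ : rk M ((S.map (Function.Embedding.subtype _) : Finset α) : Set α) = rankFun M S := by
      rw [coe_map]
      rfl
    simp only [h₁, h₂, card_map, map_mul, map_pow, map_sub, map_one, MvPolynomial.aeval_X]
    rfl

end TutteLattice

theorem theorem3p3 {α : Type*} (M : Matroid α) [M.Finite] [M.Nonempty] [Fintype M.E] :
    (∃! c : ℕ × ℕ →₀ ℚ, TutteLattice.IsBinomialExpansion (TutteLattice.rankFun M) c) ∧
    ∀ {K : Type*} [Field K] [CharZero K] (x y : K),
      x ≠ 0 → y ≠ 0 → x * y - x - y ≠ 0 →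
      MvPolynomial.aeval ![x, y] (TutteLattice.tuttePoly M) =
        -((x * y - x - y) ^ ((M.E.ncard : ℤ) - 1) /
            ((-y) ^ ((TutteLattice.rk M M.E : ℤ) - 1) *
              (-x) ^ ((M.E.ncard : ℤ) - (TutteLattice.rk M M.E : ℤ) - 1))) *
          MvPolynomial.aeval ![-x / (x * y - x - y), -y / (x * y - x - y)]
            (TutteLattice.latticePoly (TutteLattice.rankFun M)) := by
  classical
  have hr := TutteLattice.hasAdaptedBases_rankFun M
  have : Nonempty M.E := M.ground_nonempty.to_subtype
  constructor
  · obtain ⟨c, hc, -⟩ := TutteLattice.exists_isBinomialExpansion hr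
    exact ⟨c, hc, fun c' hc' => hc'.unique hc⟩
  · intro K _ _ x y hx hy hd
    have h₁ : TutteLattice.rk M M.E = TutteLattice.rankFun M Finset.univ := by
      simp [TutteLattice.rankFun]
    have h₂ : M.E.ncard = Fintype.card M.E := by
      rw [← Nat.card_coe_set_eq, Nat.card_eq_fintype_card]
    rw [TutteLattice.aeval_tuttePoly, h₁, h₂]
    exact TutteLattice.aeval_latticePoly_substituted hr hx hy hd
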